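/- Let $M(z)=\int\frac{d\rho(x)}{x-z}$ ($\operatorname{Im}z>0$) be a discrete $m$-function, i.e. the Cauchy transform of a compactly supported probability measure $\rho$ on $\mathbb R$, whose continued fraction $$M(z)=\cfrac{1}{B_1-z-\cfrac{A_1^2}{B_2-z-\cfrac{A_2^2}{B_3-z-\cdots}}}\qquad(A_n>0,\ B_n\in\mathbb R)$$ has eventually periodic coefficients: $\{(A_n,B_n)\}_{n\ge1}=\{(\alpha_1,\beta_1),\dots,(\alpha_k,\beta_k),\overline{(a_1,b_1),\dots,(a_p,b_p)}\}$ with $k\ge1$, the bar denoting infinite repetition, normalized so that $(\alpha_k,\beta_k)=(a_p,b_p)$; extend $a_j,b_j$ $p$-periodically to all $j\ge1$. Then $M$ is a root of a quadratic equation $A(z)y^2+B(z)y+C(z)=0$ with $A,B,C\in\mathbb R[z]$, $A\ne0$; let $\widetilde M$ be its second root. Let $1\le\ell<p-1$. The periodic part is called doubly palindromic with period $p$ and first length $\ell$ if $a_1,\dots,a_p$ is the concatenation of two palindromes of lengths $\ell$ and $p-\ell$, and $b_1,\dots,b_p$ is the concatenation of two palindromes of lengths $\ell+1$ and $p-\ell-1$.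 For sequences $c_j>0$, $d_j\in\mathbb R$ define $p_{-1}=0$, $p_0=1$, $zp_n=c_{n+1}p_{n+1}+d_{n+1}p_n+c_np_{n-1}$ for $n\ge0$, written $p_n(z;\{c_j,d_j\}_{j=1}^n)$, and $q_0=0$, $q_n(z;\{c_j,d_j\}_{j=1}^n)=\frac1{c_1}p_{n-1}(z;\{c_j,d_j\}_{j=2}^n)$ for $n\ge1$, and put $$T_n(\{c_j,d_j\}_{j=1}^n)=\begin{pmatrix}p_n&q_n\\-c_np_{n-1}&-c_nq_{n-1}\end{pmatrix},\qquad f_{\left(\begin{smallmatrix}a&b\\c&d\end{smallmatrix}\right)}(w)=\frac{aw+b}{cw+d}.$$ With $\alpha_0:=\alpha_k$ let $T_1=T_k(\{\alpha_j,\beta_j\}_{j=1}^k)$, $T_2=T_{\ell+1}(\{a_j,b_j\}_{j=1}^{\ell+1})$ and $T_3=T_k(\{\alpha_{k-j},\beta_{k-j+1}\}_{j=1}^k)$. Then the periodic part is doubly palindromic with period $p$ and first length $\ell$ if and only if $$\frac1{\alpha_k^2\,\widetilde M(z)}=f_{T_3T_2T_1}(M(z))$$ as meromorphic functions on the upper half-plane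 $\{\operatorname{Im}z>0\}$. -/

import Mathlib

open MeasureTheory Filter Topology Polynomial

noncomputable section

/-- The open upper half-plane, as a set of complex numbers. -/
def upperPlane : Set ℂ := {z | 0 < z.im}

/-- `M` is a discrete m-function: on the upper half-plane it is the Cauchy transform
`∫ dρ(x) / (x - z)` of a compactly supported probability measure on the real line. -/
def IsDiscreteMFunction (M : ℂ → ℂ) : Prop :=
  ∃ ρ : Measure ℝ, IsProbabilityMeasure ρ ∧ (∃ t : ℝ, ρ.support ⊆ Set.Icc (-t) t) ∧
    ∀ z ∈ upperPlane, M z = ∫ x : ℝ, 1 / ((x : ℂ) - z) ∂ρ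

/-- The continued fraction `1 / (b₁ - z - a₁² / (b₂ - z - a₂² / (b₃ - z - ⋯)))`.
Coefficient sequences are indexed from `1`; the values `a 0`, `b 0` are not used. -/
def jacobiFraction (a b : ℕ → ℝ) (z : ℂ) : GenContFract ℂ where
  h := 0
  s := Stream'.Seq.ofStream fun n : ℕ =>
    ⟨if n = 0 then 1 else -((a n : ℂ) ^ 2), (b (n + 1) : ℂ) - z⟩

/-- `{(a n, b n)}`, `n ≥ 1`, are the continued fraction coefficients of `M`: they are bounded,
each `a n` is positive, and the truncated continued fractions converge to `M` at every point of the
upper half-plane. (There no denominator of a truncation vanishes.) -/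
structure HasCFCoefficients (M : ℂ → ℂ) (a b : ℕ → ℝ) : Prop where
  pos : ∀ n, 1 ≤ n → 0 < a n
  bounded : ∃ R : ℝ, ∀ n, 1 ≤ n → a n ≤ R ∧ |b n| ≤ R
  tendsto : ∀ z ∈ upperPlane, Tendsto (fun n => (jacobiFraction a b z).convs' n) atTop (𝓝 (M z))

/-- The sequence `u₁, …, u_k, v₁, v₂, v₃, …` (indexed from `1`). -/
def prependSeq (k : ℕ) (u v : ℕ → ℝ) (n : ℕ) : ℝ :=
  if n ≤ k then u n else v (n - k)

/-- `Mt` is the second solution belonging to `M`: `M` is a root of a quadratic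
`A y² + B y + C` with real polynomial coefficients, and `Mt` is the other root (with
multiplicity), wherever the leading coefficient does not vanish. -/
def IsSecondSolution (M Mt : ℂ → ℂ) : Prop :=
  ∃ A B C : ℝ[X], A ≠ 0 ∧
    (∀ z ∈ upperPlane, aeval z A * M z ^ 2 + aeval z B * M z + aeval z C = 0) ∧
    (∀ z ∈ upperPlane, aeval z A ≠ 0 → ∀ y : ℂ,
      aeval z A * y ^ 2 + aeval z B * y + aeval z C = aeval z A * ((y - M z) * (y - Mt z)))

/-- The list `s` is the concatenation of a palindrome of length `i` and one of length `j`. -/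
def IsTwoPalindromes (s : List ℝ) (i j : ℕ) : Prop :=
  ∃ u v : List ℝ, s = u ++ v ∧ u.Palindrome ∧ v.Palindrome ∧ u.length = i ∧ v.length = j

/-- The list `u₁, …, u_p`. -/
def firstTerms (p : ℕ) (u : ℕ → ℝ) : List ℝ := (List.range p).map fun j => u (j + 1)

/-- The `p`-periodic sequence `{(a j, b j)}`, `j ≥ 1`, is doubly palindromic with period `p` and
first length `l`. -/
structure DoublyPalindromic (p l : ℕ) (a b : ℕ → ℝ) : Prop where
  periodic : ∀ j, 1 ≤ j → a (j + p) = a j ∧ b (j + p) = b j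
  left : IsTwoPalindromes (firstTerms p a) l (p - l)
  right : IsTwoPalindromes (firstTerms p b) (l + 1) (p - l - 1)

/-- Orthonormal polynomials of the first kind: `p₀ = 1`, `p₋₁ = 0` and
`z pₙ = a_{n+1} p_{n+1} + b_{n+1} pₙ + aₙ p_{n-1}`. -/
def firstKind (a b : ℕ → ℝ) : ℕ → ℝ[X]
  | 0 => 1
  | 1 => C (a 1)⁻¹ * (X - C (b 1))
  | n + 2 => C (a (n + 2))⁻¹ *
      ((X - C (b (n + 2))) * firstKind a b (n + 1) - C (a (n + 1)) * firstKind a b n)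

/-- Polynomials of the second kind: `q₀ = 0` and `qₙ = p_{n-1} / a₁` for `n ≥ 1`, with `p_{n-1}`
built from the coefficients shifted by one. -/
def secondKind (a b : ℕ → ℝ) : ℕ → ℝ[X]
  | 0 => 0
  | n + 1 => C (a 1)⁻¹ * firstKind (fun j => a (j + 1)) (fun j => b (j + 1)) n

/-- The conjugated transfer matrix
`(p_n, q_n; -a_n p_{n-1}, -a_n q_{n-1})` at `z` of the first `n` coefficients (`n ≥ 1`). -/
def conjTransfer (n : ℕ) (a b : ℕ → ℝ) (z : ℂ) : Matrix (Fin 2) (Fin 2) ℂ :=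
  !![aeval z (firstKind a b n), aeval z (secondKind a b n);
    -(a n : ℂ) * aeval z (firstKind a b (n - 1)), -(a n : ℂ) * aeval z (secondKind a b (n - 1))]

/-- The fractional linear transformation `f_T(w) = (a w + b) / (c w + d)`. -/
def fracLin (T : Matrix (Fin 2) (Fin 2) ℂ) (w : ℂ) : ℂ :=
  (T 0 0 * w + T 0 1) / (T 1 0 * w + T 1 1)

end

/-!
The quadratic equation of `M` says that `(M, 1)` is mapped by the transfer matrix `T₁` of the
pre-period to an eigenvector of the transfer matrix `N` of one period; the second solution `Mt`
belongs to the other eigenvector. One step of a transfer matrix satisfies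
`S(e, d) E_c S(c, d) = E_e`, where `E_c` is the matrix of the involution `w ↦ 1 / (c² w)`
(`stepMatrix_mul_reflMatrix_mul`). Hence, with `c = α_k = a_p`, the matrices of the reversed
coefficients are the `E_c`-conjugates of inverses: `T₃ = E_c T₁⁻¹ E_c` and `R = E_c N⁻¹ E_c`, where
`R` is the transfer matrix of the reversed period (`stepProd_reverse`, `stepProd_reverse_period`).

Let `x` be the function obtained from the periodic m-function by stripping `l + 1` further
coefficients, so that `f_{T₂ T₁}(M) = x`. By these relations the identity of the theorem holds at a
point exactly when `x` is a fixed point of `R` there (`wedge_eq_zero_iff_reflection`). This uses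
that `M` is not rational, so that the given quadratic equation is proportional to the one coming
from `N` (`eq_zero_of_linear_relation`, `fixedForm_eq_mul`), and that the two zeros are told apart
by the sign of the imaginary part.

If the period is doubly palindromic, `x` has the reversed sequence as its own coefficients and so is
fixed by `R`. Conversely, if `x` is fixed by `R`, then, lying in the upper half-plane, it has a
continued fraction with the reversed coefficients (`exists_isStripping_of_fixed`), and the
asymptotics `z m(z) → -1` show that the coefficients are unique (`coeff_eq_of_isStripping`).
Equality of the two sequences is a reflection symmetry of the indices modulo `p`, which is what
being doubly palindromic means (`doublyPalindromic_iff`).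
-/

open Matrix

/-! ### Truncated continued fractions in the upper half-plane -/

/-- `unstrip A B z n j w` is the finite continued fraction
`1 / (B_{j+1} - z - A_{j+1}² / (⋯ - A_{j+n-1}² / (B_{j+n} - z - A_{j+n}² w)))`: it prepends the
`n` coefficients with indices `j + 1, …, j + n` to the value `w`. -/
noncomputable def unstrip (A B : ℕ → ℝ) (z : ℂ) : ℕ → ℕ → ℂ → ℂ
  | 0, _, w => w
  | n + 1, j, w => 1 / ((B (j + 1) : ℂ) - z - (A (j + 1) : ℂ) ^ 2 * unstrip A B z n (j + 1) w)

/-- `g` is a sequence of values at `z`, all in the upper half-plane, in which `g j` has the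
continued fraction expansion with coefficients `A_{j+1}, B_{j+1}` and remainder `g (j + 1)`. This
is what the successively stripped m-functions of a Jacobi matrix do at a point `z`. -/
structure IsStripping (A B : ℕ → ℝ) (z : ℂ) (g : ℕ → ℂ) : Prop where
  im_pos : ∀ j, 0 < (g j).im
  step : ∀ j, g j * ((B (j + 1) : ℂ) - z - (A (j + 1) : ℂ) ^ 2 * g (j + 1)) = 1

theorem stripDenom_im (c d : ℝ) (z w : ℂ) :
    ((d : ℂ) - z - (c : ℂ) ^ 2 * w).im = -z.im - c ^ 2 * w.im := by
  simp [← Complex.ofReal_pow]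

theorem le_norm_stripDenom (c d : ℝ) {z w : ℂ} (hw : 0 ≤ w.im) :
    z.im ≤ ‖(d : ℂ) - z - (c : ℂ) ^ 2 * w‖ := by
  refine le_trans ?_ (Complex.abs_im_le_norm _)
  rw [stripDenom_im, le_abs]
  right
  nlinarith [mul_nonneg (sq_nonneg c) hw]

theorem stripDenom_ne_zero (c d : ℝ) {z w : ℂ} (hz : 0 < z.im) (hw : 0 ≤ w.im) :
    (d : ℂ) - z - (c : ℂ) ^ 2 * w ≠ 0 :=
  norm_pos_iff.1 (hz.trans_le (le_norm_stripDenom c d hw))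

theorem im_pos_of_mul_stripDenom {c d : ℝ} {z w v : ℂ} (hz : 0 < z.im) (hw : 0 ≤ w.im)
    (h : v * ((d : ℂ) - z - (c : ℂ) ^ 2 * w) = 1) : 0 < v.im := by
  have hv : v = ((d : ℂ) - z - (c : ℂ) ^ 2 * w)⁻¹ := eq_inv_of_mul_eq_one_left h
  rw [hv, Complex.inv_im, stripDenom_im]
  have : 0 < Complex.normSq ((d : ℂ) - z - (c : ℂ) ^ 2 * w) :=
    Complex.normSq_pos.2 (stripDenom_ne_zero c d hz hw)
  refine div_pos ?_ this
  nlinarith [mul_nonneg (sq_nonneg c) hw]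

theorem norm_le_of_mul_stripDenom {c d : ℝ} {z w v : ℂ} (hz : 0 < z.im) (hw : 0 ≤ w.im)
    (h : v * ((d : ℂ) - z - (c : ℂ) ^ 2 * w) = 1) : ‖v‖ ≤ 1 / z.im := by
  have h1 : ‖v‖ * ‖(d : ℂ) - z - (c : ℂ) ^ 2 * w‖ = 1 := by rw [← norm_mul, h, norm_one]
  rw [le_div_iff₀ hz, ← h1]
  exact mul_le_mul_of_nonneg_left (le_norm_stripDenom c d hw) (norm_nonneg _)

section

variable {A B A' B' : ℕ → ℝ} {z : ℂ}

theorem unstrip_im_nonneg (hz : 0 < z.im) {w : ℂ} (hw : 0 ≤ w.im) (n j : ℕ) :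
    0 ≤ (unstrip A B z n j w).im := by
  induction n generalizing j with
  | zero => exact hw
  | succ n ih =>
    exact (im_pos_of_mul_stripDenom (c := A (j + 1)) (d := B (j + 1)) hz (ih (j + 1))
      (one_div_mul_cancel (stripDenom_ne_zero _ _ hz (ih (j + 1))))).le

theorem unstrip_succ_mul (hz : 0 < z.im) {w : ℂ} (hw : 0 ≤ w.im) (n j : ℕ) :
    unstrip A B z (n + 1) j w *
      ((B (j + 1) : ℂ) - z - (A (j + 1) : ℂ) ^ 2 * unstrip A B z n (j + 1) w) = 1 :=
  one_div_mul_cancel (stripDenom_ne_zero _ _ hz (unstrip_im_nonneg hz hw n (j + 1)))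

theorem unstrip_succ_im_pos (hz : 0 < z.im) {w : ℂ} (hw : 0 ≤ w.im) (n j : ℕ) :
    0 < (unstrip A B z (n + 1) j w).im :=
  im_pos_of_mul_stripDenom hz (unstrip_im_nonneg hz hw n (j + 1)) (unstrip_succ_mul hz hw n j)

theorem unstrip_im_pos (hz : 0 < z.im) {w : ℂ} (hw : 0 < w.im) (n j : ℕ) :
    0 < (unstrip A B z n j w).im := by
  cases n with
  | zero => exact hw
  | succ n => exact unstrip_succ_im_pos hz hw.le n j

theorem unstrip_add (m n j : ℕ) (w : ℂ) :
    unstrip A B z (m + n) j w = unstrip A B z m j (unstrip A B z n (j + m) w) := by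
  induction m generalizing j with
  | zero => simp [unstrip]
  | succ m ih => rw [Nat.add_right_comm, unstrip, unstrip, ih, Nat.add_right_comm j 1 m]; rfl

theorem unstrip_congr {i j : ℕ} (h : ∀ s, 1 ≤ s → A (i + s) = A' (j + s) ∧ B (i + s) = B' (j + s))
    (n : ℕ) (w : ℂ) : unstrip A B z n i w = unstrip A' B' z n j w := by
  induction n generalizing i j with
  | zero => rfl
  | succ n ih =>
    rw [unstrip, unstrip, (h 1 le_rfl).1, (h 1 le_rfl).2, ih (i := i + 1) (j := j + 1)]
    intro s hs
    have := h (1 + s) (by omega)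
    simpa only [add_assoc] using this

theorem convs'Aux_jacobi (n j : ℕ) :
    GenContFract.convs'Aux (Stream'.Seq.ofStream fun i : ℕ =>
      (⟨if i + j = 0 then 1 else -((A (i + j) : ℂ) ^ 2), (B (i + j + 1) : ℂ) - z⟩ :
        GenContFract.Pair ℂ)) n =
      (if j = 0 then 1 else -((A j : ℂ) ^ 2)) * unstrip A B z n j 0 := by
  induction n generalizing j with
  | zero => simp [GenContFract.convs'Aux, unstrip]
  | succ n ih =>
    have h1 : (Stream'.Seq.ofStream fun i : ℕ =>
      (⟨if i + j = 0 then 1 else -((A (i + j) : ℂ) ^ 2), (B (i + j + 1) : ℂ) - z⟩ :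
        GenContFract.Pair ℂ)).head =
        some ⟨if j = 0 then 1 else -((A j : ℂ) ^ 2), (B (j + 1) : ℂ) - z⟩ := by
      change some (⟨if 0 + j = 0 then 1 else -((A (0 + j) : ℂ) ^ 2), (B (0 + j + 1) : ℂ) - z⟩ :
        GenContFract.Pair ℂ) = some _
      rw [zero_add]
    have h2 : (Stream'.Seq.ofStream fun i : ℕ =>
      (⟨if i + j = 0 then 1 else -((A (i + j) : ℂ) ^ 2), (B (i + j + 1) : ℂ) - z⟩ :
        GenContFract.Pair ℂ)).tail = Stream'.Seq.ofStream fun i : ℕ =>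
      (⟨if i + (j + 1) = 0 then 1 else -((A (i + (j + 1)) : ℂ) ^ 2),
        (B (i + (j + 1) + 1) : ℂ) - z⟩ : GenContFract.Pair ℂ) := by
      apply Subtype.ext
      funext i
      change some (⟨if i + 1 + j = 0 then 1 else -((A (i + 1 + j) : ℂ) ^ 2),
        (B (i + 1 + j + 1) : ℂ) - z⟩ : GenContFract.Pair ℂ) = some
        ⟨if i + (j + 1) = 0 then 1 else -((A (i + (j + 1)) : ℂ) ^ 2),
        (B (i + (j + 1) + 1) : ℂ) - z⟩
      rw [show i + 1 + j = i + (j + 1) by omega]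
    rw [GenContFract.convs'Aux, h1, h2]
    simp only [ih, unstrip, Nat.succ_ne_zero, if_false]
    rw [mul_one_div]
    congr 1
    ring

theorem jacobiFraction_convs' (n : ℕ) :
    (jacobiFraction A B z).convs' n = unstrip A B z n 0 0 := by
  have := convs'Aux_jacobi (A := A) (B := B) (z := z) n 0
  simpa [GenContFract.convs', jacobiFraction] using this

/-- If the truncations converge, so do those of all tails of the continued fraction. -/
theorem exists_isStripping (hA : ∀ j, 1 ≤ j → 0 < A j) (hz : 0 < z.im) {m : ℂ}
    (hm : Tendsto (fun n => unstrip A B z n 0 0) atTop (𝓝 m)) :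
    ∃ g : ℕ → ℂ, g 0 = m ∧ IsStripping A B z g ∧
      ∀ j, Tendsto (fun n => unstrip A B z n j 0) atTop (𝓝 (g j)) := by
  have h0 : (0 : ℝ) ≤ (0 : ℂ).im := le_rfl
  have key : ∀ j, ∃ L, Tendsto (fun n => unstrip A B z n j 0) atTop (𝓝 L) := by
    intro j
    induction j with
    | zero => exact ⟨m, hm⟩
    | succ j ih =>
      obtain ⟨L, hL⟩ := ih
      have hL1 := hL.comp (tendsto_add_atTop_nat 1)
      -- the denominators stay bounded, so that the limit cannot vanish
      have hbd : ∀ n, 1 ≤ ‖unstrip A B z (n + 1 + 1) j 0‖ *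
          (‖(B (j + 1) : ℂ) - z‖ + ‖(A (j + 1) : ℂ) ^ 2‖ * (1 / z.im)) := by
        intro n
        have h1 := congrArg norm (unstrip_succ_mul (A := A) (B := B) hz h0 (n + 1) j)
        rw [norm_mul, norm_one] at h1
        refine h1.symm.le.trans ?_
        refine mul_le_mul_of_nonneg_left ((norm_sub_le _ _).trans ?_) (norm_nonneg _)
        rw [norm_mul]
        gcongr
        exact norm_le_of_mul_stripDenom hz (unstrip_im_nonneg hz h0 n (j + 2))
          (unstrip_succ_mul hz h0 n (j + 1))
      have hL0 : L ≠ 0 := by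
        rintro rfl
        have h2 := ((hL.comp (tendsto_add_atTop_nat 2)).norm.mul_const
          (‖(B (j + 1) : ℂ) - z‖ + ‖(A (j + 1) : ℂ) ^ 2‖ * (1 / z.im)))
        have h3 := ge_of_tendsto' h2 hbd
        simp at h3
        linarith
      refine ⟨((B (j + 1) : ℂ) - z - L⁻¹) / (A (j + 1) : ℂ) ^ 2, ?_⟩
      have h4 := (((hL1.inv₀ hL0).const_sub ((B (j + 1) : ℂ) - z)).div_const
        ((A (j + 1) : ℂ) ^ 2))
      refine h4.congr fun n => ?_
      have hA' : (A (j + 1) : ℂ) ≠ 0 := by exact_mod_cast (hA (j + 1) (by omega)).ne'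
      have h5 := eq_inv_of_mul_eq_one_right (unstrip_succ_mul (A := A) (B := B) hz h0 n j)
      simp only [Function.comp_apply]
      rw [← h5]
      field_simp
      ring
  choose g hg using key
  have hstep : ∀ j, g j * ((B (j + 1) : ℂ) - z - (A (j + 1) : ℂ) ^ 2 * g (j + 1)) = 1 := by
    intro j
    have h1 := ((hg j).comp (tendsto_add_atTop_nat 1)).mul
      (((hg (j + 1)).const_mul ((A (j + 1) : ℂ) ^ 2)).const_sub ((B (j + 1) : ℂ) - z))
    refine tendsto_nhds_unique h1 (tendsto_const_nhds.congr fun n => ?_)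
    exact (unstrip_succ_mul hz h0 n j).symm
  have him : ∀ j, 0 ≤ (g j).im := fun j =>
    ge_of_tendsto' ((Complex.continuous_im.tendsto _).comp (hg j))
      fun n => unstrip_im_nonneg hz h0 n j
  exact ⟨g, tendsto_nhds_unique (hg 0) hm,
    ⟨fun j => im_pos_of_mul_stripDenom hz (him (j + 1)) (hstep j), hstep⟩, hg⟩

/-! ### Stripped sequences -/

namespace IsStripping

variable {g : ℕ → ℂ}

theorem ne_zero (h : IsStripping A B z g) (j : ℕ) : g j ≠ 0 := left_ne_zero_of_mul_eq_one (h.step j)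

theorem norm_le (h : IsStripping A B z g) (hz : 0 < z.im) (j : ℕ) : ‖g j‖ ≤ 1 / z.im :=
  norm_le_of_mul_stripDenom hz (h.im_pos (j + 1)).le (h.step j)

theorem shift (h : IsStripping A B z g) (i : ℕ) :
    IsStripping (fun j => A (i + j)) (fun j => B (i + j)) z (fun j => g (i + j)) :=
  ⟨fun j => h.im_pos (i + j), fun j => h.step (i + j)⟩

theorem congr (h : IsStripping A B z g) (hc : ∀ j, 1 ≤ j → A j = A' j ∧ B j = B' j) :
    IsStripping A' B' z g := by
  refine ⟨h.im_pos, fun j => ?_⟩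
  rw [← (hc (j + 1) (by omega)).1, ← (hc (j + 1) (by omega)).2]
  exact h.step j

end IsStripping

/-- A value in the upper half-plane that is reproduced by one period of the continued fraction
heads a stripped sequence. -/
theorem exists_isStripping_of_fixed {p : ℕ} (hp : 1 ≤ p)
    (hper : ∀ j, 1 ≤ j → A (j + p) = A j ∧ B (j + p) = B j) (hz : 0 < z.im) {x : ℂ}
    (hx : 0 < x.im) (hfix : unstrip A B z p 0 x = x) :
    ∃ g : ℕ → ℂ, g 0 = x ∧ IsStripping A B z g := by
  have hfix' : ∀ i, unstrip A B z p (p * i) x = x := by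
    intro i
    have hshift : ∀ s, 1 ≤ s → A (p * i + s) = A (0 + s) ∧ B (p * i + s) = B (0 + s) := by
      induction i with
      | zero => simp
      | succ i ih =>
        intro s hs
        rw [← (ih s hs).1, ← (ih s hs).2, ← (hper (p * i + s) (by omega)).1,
          ← (hper (p * i + s) (by omega)).2]
        constructor <;> congr 1 <;> ring
    rw [unstrip_congr hshift, hfix]
  -- unstripping from `j` up to the multiple `p * j` of the period, where the value is `x`
  refine ⟨fun j => unstrip A B z (p * j - j) j x, by simp [unstrip],
    fun j => unstrip_im_pos hz hx _ _, fun j => ?_⟩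
  have hj : j ≤ p * j := Nat.le_mul_of_pos_left j hp
  have h1 : unstrip A B z (p * j - j) j x = unstrip A B z (p * j - j + p) j x := by
    rw [unstrip_add, show j + (p * j - j) = p * j by omega, hfix']
  have h2 : p * j - j + p = (p * (j + 1) - (j + 1)) + 1 := by
    have : p * (j + 1) = p * j + p := by ring
    omega
  rw [h1, h2]
  exact unstrip_succ_mul hz hx.le _ _

theorem tendsto_zero_of_norm_le {z g : ℕ → ℂ}
    (hz : Tendsto (fun n => (z n).im) atTop atTop) (hg : ∀ n, ‖g n‖ ≤ 1 / (z n).im) :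
    Tendsto g atTop (𝓝 0) := by
  refine squeeze_zero_norm hg ?_
  simpa only [one_div, Pi.inv_def] using hz.inv_tendsto_atTop

/-- The normalization `z m(z) → -1` of an m-function. -/
theorem tendsto_mul_of_isStripping {z : ℕ → ℂ} {g : ℕ → ℕ → ℂ} (hz : ∀ n, 0 < (z n).im)
    (hzlim : Tendsto (fun n => (z n).im) atTop atTop) (hg : ∀ n, IsStripping A B (z n) (g n))
    (j : ℕ) : Tendsto (fun n => z n * g n j) atTop (𝓝 (-1)) := by
  have h0 : ∀ j, Tendsto (fun n => g n j) atTop (𝓝 0) := fun j =>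
    tendsto_zero_of_norm_le hzlim fun n => (hg n).norm_le (hz n) j
  have h1 := (((h0 j).const_mul (B (j + 1) : ℂ)).sub
    (((h0 j).mul (h0 (j + 1))).const_mul ((A (j + 1) : ℂ) ^ 2))).sub_const 1
  simp only [mul_zero, sub_zero, zero_sub] at h1
  refine h1.congr fun n => ?_
  linear_combination (hg n).step j

/-- The continued fraction coefficients are determined by the values of the m-function along a
sequence of points whose imaginary parts tend to infinity. -/
theorem coeff_eq_of_isStripping (hA : ∀ j, 1 ≤ j → 0 < A j) (hA' : ∀ j, 1 ≤ j → 0 < A' j)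
    {z : ℕ → ℂ} (hz : ∀ n, 0 < (z n).im) (hzlim : Tendsto (fun n => (z n).im) atTop atTop)
    {g h : ℕ → ℕ → ℂ} (hg : ∀ n, IsStripping A B (z n) (g n))
    (hh : ∀ n, IsStripping A' B' (z n) (h n)) (h0 : ∀ n, g n 0 = h n 0) (j : ℕ) :
    A (j + 1) = A' (j + 1) ∧ B (j + 1) = B' (j + 1) := by
  have hstep : ∀ j, (∀ n, g n j = h n j) →
      (A (j + 1) = A' (j + 1) ∧ B (j + 1) = B' (j + 1)) ∧ ∀ n, g n (j + 1) = h n (j + 1) := by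
    intro j hj
    have h1 : ∀ n, (A (j + 1) : ℂ) ^ 2 * g n (j + 1) - (A' (j + 1) : ℂ) ^ 2 * h n (j + 1) =
        B (j + 1) - B' (j + 1) := by
      intro n
      have h2 := (hg n).step j
      rw [hj n, ← (hh n).step j] at h2
      have h3 := mul_left_cancel₀ ((hh n).ne_zero j) h2
      linear_combination -h3
    have hg0 : Tendsto (fun n => g n (j + 1)) atTop (𝓝 0) :=
      tendsto_zero_of_norm_le hzlim fun n => (hg n).norm_le (hz n) _
    have hh0 : Tendsto (fun n => h n (j + 1)) atTop (𝓝 0) :=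
      tendsto_zero_of_norm_le hzlim fun n => (hh n).norm_le (hz n) _
    have hB : (B (j + 1) : ℂ) - B' (j + 1) = 0 := by
      have h2 := (hg0.const_mul ((A (j + 1) : ℂ) ^ 2)).sub
        (hh0.const_mul ((A' (j + 1) : ℂ) ^ 2))
      simp only [h1, mul_zero, sub_zero] at h2
      exact tendsto_nhds_unique tendsto_const_nhds h2
    have hAsq : (A (j + 1) : ℂ) ^ 2 = (A' (j + 1) : ℂ) ^ 2 := by
      have h2 := (tendsto_mul_of_isStripping hz hzlim hg (j + 1)).const_mul
        ((A (j + 1) : ℂ) ^ 2)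
      have h3 := (tendsto_mul_of_isStripping hz hzlim hh (j + 1)).const_mul
        ((A' (j + 1) : ℂ) ^ 2)
      have h4 := tendsto_nhds_unique (h2.congr fun n => ?_) h3
      · linear_combination -h4
      · have h5 := h1 n
        rw [hB] at h5
        linear_combination z n * h5
    have hApos := hA (j + 1) (by omega)
    refine ⟨⟨?_, ?_⟩, fun n => ?_⟩
    · have h2 : A (j + 1) ^ 2 = A' (j + 1) ^ 2 := by exact_mod_cast hAsq
      exact (pow_left_inj₀ hApos.le (hA' (j + 1) (by omega)).le two_ne_zero).1 h2
    · exact_mod_cast sub_eq_zero.1 hB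
    · have h5 := h1 n
      rw [hB, ← hAsq] at h5
      have h6 : (A (j + 1) : ℂ) ^ 2 ≠ 0 := by exact_mod_cast (pow_pos hApos 2).ne'
      exact mul_left_cancel₀ h6 (sub_eq_zero.1 h5)
  have hall : ∀ j n, g n j = h n j := by
    intro j
    induction j with
    | zero => exact h0
    | succ j ih => exact (hstep j ih).2
  exact (hstep j (hall j)).1

/-! ### An m-function with infinitely many coefficients is not rational -/

theorem tendsto_aeval_div_pow (P : ℝ[X]) :
    Tendsto (fun z : ℂ => aeval z P / z ^ P.natDegree) (Bornology.cobounded ℂ)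
      (𝓝 (P.leadingCoeff : ℂ)) := by
  have h1 : Tendsto (fun z : ℂ => aeval z⁻¹ P.reverse) (Bornology.cobounded ℂ)
      (𝓝 (aeval (0 : ℂ) P.reverse)) :=
    (P.reverse.continuous_aeval.tendsto (0 : ℂ)).comp tendsto_inv₀_cobounded
  have h2 : aeval (0 : ℂ) P.reverse = (P.leadingCoeff : ℂ) := by
    rw [← coeff_zero_reverse, ← coeff_zero_eq_aeval_zero', Complex.coe_algebraMap]
  rw [h2] at h1
  refine h1.congr' ?_
  filter_upwards [Bornology.isBounded_singleton (x := (0 : ℂ))] with z hz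
  have hz0 : z ≠ 0 := hz
  let := invertibleOfNonzero hz0
  have h3 := eval₂_reverse_mul_pow (algebraMap ℝ ℂ) z P
  rw [invOf_eq_inv] at h3
  rw [aeval_def, aeval_def, ← h3, mul_div_cancel_right₀ _ (pow_ne_zero _ hz0)]

theorem eq_zero_of_aeval_upperPlane {P : ℝ[X]} (h : ∀ z ∈ upperPlane, aeval z P = 0) : P = 0 := by
  by_contra hP
  have h1 : (P.rootSet ℂ).Finite := P.rootSet_finite ℂ
  refine (Set.infinite_of_injective_forall_mem (f := fun n : ℕ => ((n : ℂ) + 1) * Complex.I)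
    ?_ ?_) h1
  · intro m n hmn
    simpa using hmn
  · intro n
    refine (mem_rootSet).2 ⟨hP, h _ ?_⟩
    simp [upperPlane]
    positivity

theorem natDegree_lt_of_norm_mul_le {E F : ℝ[X]} (hF : F ≠ 0)
    (h : ∀ z ∈ upperPlane, ‖aeval z F‖ ≤ ‖aeval z E‖ * (1 / z.im)) :
    F.natDegree < E.natDegree := by
  by_contra! hle
  set y : ℕ → ℂ := fun n => ((n : ℂ) + 1) * Complex.I with hy
  have hyim : ∀ n, (y n).im = n + 1 := by intro n; simp [hy]
  have hynorm : ∀ n, ‖y n‖ = n + 1 := by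
    intro n
    simp only [hy, norm_mul, Complex.norm_I, mul_one]
    exact_mod_cast Complex.norm_natCast (n + 1)
  have hlim : Tendsto (fun n : ℕ => (n : ℝ) + 1) atTop atTop :=
    tendsto_atTop_add_const_right _ _ tendsto_natCast_atTop_atTop
  have hycob : Tendsto y atTop (Bornology.cobounded ℂ) := by
    rw [← tendsto_norm_atTop_iff_cobounded]
    simpa only [hynorm] using hlim
  have h1 := ((tendsto_aeval_div_pow E).comp hycob).norm.mul hlim.inv_tendsto_atTop
  rw [mul_zero] at h1
  have h2 : Tendsto (fun n => aeval (y n) F / (y n) ^ F.natDegree) atTop (𝓝 0) := by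
    refine squeeze_zero_norm (fun n => ?_) h1
    have hn : (1 : ℝ) ≤ ‖y n‖ := by rw [hynorm]; linarith [Nat.cast_nonneg (α := ℝ) n]
    simp only [Function.comp_apply, norm_div, norm_pow, Pi.inv_apply]
    have h3 := h (y n) (by change 0 < (y n).im; rw [hyim]; positivity)
    rw [hyim, one_div] at h3
    calc _ ≤ ‖aeval (y n) E‖ * ((n : ℝ) + 1)⁻¹ / ‖y n‖ ^ F.natDegree := by gcongr
      _ ≤ ‖aeval (y n) E‖ * ((n : ℝ) + 1)⁻¹ / ‖y n‖ ^ E.natDegree := by gcongr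
      _ = _ := by ring
  have h3 := tendsto_nhds_unique h2 ((tendsto_aeval_div_pow F).comp hycob)
  exact hF (leadingCoeff_eq_zero.1 (by exact_mod_cast h3.symm))

/-- A function with an infinite continued fraction is not rational: stripping a coefficient turns
a linear relation `E M + F = 0` into one of lower degree. -/
theorem eq_zero_of_linear_relation (hA : ∀ j, 1 ≤ j → 0 < A j) {g : ℂ → ℕ → ℂ}
    (hg : ∀ z ∈ upperPlane, IsStripping A B z (g z)) {E F : ℝ[X]}
    (h : ∀ z ∈ upperPlane, aeval z E * g z 0 + aeval z F = 0) : E = 0 ∧ F = 0 := by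
  suffices hE : E = 0 by
    refine ⟨hE, eq_zero_of_aeval_upperPlane fun z hz => ?_⟩
    simpa [hE] using h z hz
  induction hn : E.natDegree using Nat.strong_induction_on generalizing E F A B g with
  | _ n ih =>
  by_cases hF : F = 0
  · refine eq_zero_of_aeval_upperPlane fun z hz => ?_
    have := h z hz
    rw [hF, map_zero, add_zero] at this
    exact (mul_eq_zero.1 this).resolve_right ((hg z hz).ne_zero 0)
  have hlt : F.natDegree < E.natDegree := by
    refine natDegree_lt_of_norm_mul_le hF fun z hz => ?_
    rw [eq_neg_of_add_eq_zero_right (h z hz), norm_neg, norm_mul]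
    gcongr
    exact (hg z hz).norm_le hz 0
  have hA1 : -A 1 ^ 2 ≠ 0 := (neg_neg_of_pos (pow_pos (hA 1 le_rfl) 2)).ne
  have h1 : C (-A 1 ^ 2) * F = 0 := by
    refine ih F.natDegree (hn ▸ hlt) (A := fun j => A (1 + j)) (B := fun j => B (1 + j))
      (g := fun z j => g z (1 + j)) (F := E + F * (C (B 1) - X))
      (fun j hj => hA _ (by omega)) (fun z hz => (hg z hz).shift 1) (fun z hz => ?_)
      (natDegree_C_mul hA1)
    have h2 := (hg z hz).step 0
    have h3 := h z hz
    simp only [map_mul, map_add, map_sub, aeval_C, aeval_X, Complex.coe_algebraMap]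
    push_cast
    simp only [zero_add] at h2 ⊢
    linear_combination ((B 1 : ℂ) - z - (A 1 : ℂ) ^ 2 * g z 1) * h3 - aeval z E * h2
  exact absurd ((mul_eq_zero.1 h1).resolve_left (by simpa using hA1)) hF

end

/-! ### Transfer matrices -/

/-- The conjugated transfer matrix of a single coefficient pair. As a fractional linear
transformation it strips this pair from a continued fraction. -/
noncomputable def stepMatrix (c d : ℝ) (z : ℂ) : Matrix (Fin 2) (Fin 2) ℂ :=
  !![(z - d) / c, 1 / (c : ℂ); -(c : ℂ), 0]

/-- The product of the one-step transfer matrices with indices `n, …, 1`. -/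
noncomputable def stepProd (a b : ℕ → ℝ) (z : ℂ) : ℕ → Matrix (Fin 2) (Fin 2) ℂ
  | 0 => 1
  | n + 1 => stepMatrix (a (n + 1)) (b (n + 1)) z * stepProd a b z n

theorem secondKind_add_two (a b : ℕ → ℝ) (n : ℕ) :
    secondKind a b (n + 2) = C (a (n + 2))⁻¹ *
      ((X - C (b (n + 2))) * secondKind a b (n + 1) - C (a (n + 1)) * secondKind a b n) := by
  cases n with
  | zero => simp only [secondKind, firstKind]; ring
  | succ n => simp only [secondKind, firstKind]; ring

theorem conjTransfer_succ (a b : ℕ → ℝ) (z : ℂ) (n : ℕ) :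
    conjTransfer (n + 2) a b z =
      stepMatrix (a (n + 2)) (b (n + 2)) z * conjTransfer (n + 1) a b z := by
  simp only [conjTransfer, stepMatrix, Matrix.mul_fin_two, Nat.add_sub_cancel,
    show n + 2 - 1 = n + 1 by omega, secondKind_add_two, firstKind, map_mul, map_sub, aeval_C,
    aeval_X, Complex.coe_algebraMap, Complex.ofReal_inv]
  congr 1
  ext i j
  fin_cases i <;> fin_cases j <;> simp <;> ring

theorem conjTransfer_eq_stepProd (a b : ℕ → ℝ) (z : ℂ) {n : ℕ} (hn : 1 ≤ n) :
    conjTransfer n a b z = stepProd a b z n := by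
  induction n, hn using Nat.le_induction with
  | base =>
    simp [conjTransfer, stepProd, stepMatrix, firstKind, secondKind, div_eq_inv_mul]
  | succ n hn ih =>
    obtain ⟨m, rfl⟩ : ∃ m, n = m + 1 := ⟨n - 1, by omega⟩
    rw [conjTransfer_succ, ih]
    rfl

theorem stepProd_congr {a b a' b' : ℕ → ℝ} (z : ℂ) {n : ℕ}
    (h : ∀ j, 1 ≤ j → j ≤ n → a j = a' j ∧ b j = b' j) : stepProd a b z n = stepProd a' b' z n := by
  induction n with
  | zero => rfl
  | succ n ih =>
    rw [stepProd, stepProd, (h (n + 1) (by omega) le_rfl).1, (h (n + 1) (by omega) le_rfl).2,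
      ih fun j h1 h2 => h j h1 (by omega)]

theorem det_stepProd {a b : ℕ → ℝ} (z : ℂ) {n : ℕ} (h : ∀ j, 1 ≤ j → j ≤ n → a j ≠ 0) :
    (stepProd a b z n).det = 1 := by
  induction n with
  | zero => simp [stepProd]
  | succ n ih =>
    have h1 : (a (n + 1) : ℂ) ≠ 0 := by exact_mod_cast h (n + 1) (by omega) le_rfl
    rw [stepProd, det_mul, ih fun j h1 h2 => h j h1 (by omega), mul_one, stepMatrix, det_fin_two_of]
    field_simp
    ring

/-- Transfer matrices strip coefficients from a continued fraction, in homogeneous coordinates. -/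
theorem stepProd_mulVec {a b : ℕ → ℝ} {z : ℂ} {g : ℕ → ℂ} {n : ℕ}
    (ha : ∀ j, 1 ≤ j → j ≤ n → a j ≠ 0)
    (hg : ∀ j, j < n → g j * ((b (j + 1) : ℂ) - z - (a (j + 1) : ℂ) ^ 2 * g (j + 1)) = 1) :
    ∃ μ : ℂ, μ ≠ 0 ∧ stepProd a b z n *ᵥ ![g 0, 1] = μ • ![g n, 1] := by
  induction n with
  | zero => exact ⟨1, one_ne_zero, by simp [stepProd]⟩
  | succ n ih =>
    obtain ⟨μ, hμ, h⟩ := ih (fun j h1 h2 => ha j h1 (by omega)) fun j hj => hg j (by omega)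
    have h1 : (a (n + 1) : ℂ) ≠ 0 := by exact_mod_cast ha (n + 1) (by omega) le_rfl
    have h2 := hg n n.lt_succ_self
    have h3 : g n ≠ 0 := left_ne_zero_of_mul_eq_one h2
    refine ⟨μ * (-(a (n + 1) : ℂ) * g n), by simp [hμ, h1, h3], ?_⟩
    rw [stepProd, ← mulVec_mulVec, h, mulVec_smul, mul_smul]
    congr 1
    ext i
    fin_cases i
    · simp [stepMatrix, mulVec, dotProduct, Fin.sum_univ_two]
      field_simp
      linear_combination -h2
    · simp [stepMatrix, mulVec, dotProduct, Fin.sum_univ_two]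

theorem stepProd_mulVec_unstrip {a b : ℕ → ℝ} {z w : ℂ} {n : ℕ} (hz : 0 < z.im) (hw : 0 ≤ w.im)
    (ha : ∀ j, 1 ≤ j → j ≤ n → a j ≠ 0) :
    ∃ μ : ℂ, μ ≠ 0 ∧ stepProd a b z n *ᵥ ![unstrip a b z n 0 w, 1] = μ • ![w, 1] := by
  have := stepProd_mulVec (b := b) (z := z) (g := fun j => unstrip a b z (n - j) j w) ha
    fun j hj => by
      rw [show n - j = n - (j + 1) + 1 by omega]
      exact unstrip_succ_mul hz hw _ _
  simpa [unstrip] using this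

/-- The involution `w ↦ 1 / (c² w)`, as a matrix of determinant `-1`. It carries the second root of
the fixed-point equation of a periodic m-function to the m-function of the reversed sequence. -/
noncomputable def reflMatrix (c : ℝ) : Matrix (Fin 2) (Fin 2) ℂ := !![0, 1 / (c : ℂ); (c : ℂ), 0]

theorem reflMatrix_mul_self {c : ℝ} (hc : c ≠ 0) : reflMatrix c * reflMatrix c = 1 := by
  have : (c : ℂ) ≠ 0 := by exact_mod_cast hc
  simp [reflMatrix, this, one_fin_two]

theorem det_reflMatrix {c : ℝ} (hc : c ≠ 0) : (reflMatrix c).det = -1 := by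
  have : (c : ℂ) ≠ 0 := by exact_mod_cast hc
  simp [reflMatrix, det_fin_two_of, this]

theorem stepMatrix_mul_reflMatrix_mul {c : ℝ} (hc : c ≠ 0) (d e : ℝ) (z : ℂ) :
    stepMatrix e d z * reflMatrix c * stepMatrix c d z = reflMatrix e := by
  have hc' : (c : ℂ) ≠ 0 := by exact_mod_cast hc
  simp only [stepMatrix, reflMatrix, Matrix.mul_fin_two]
  congr 1
  ext i j
  fin_cases i <;> fin_cases j <;> simp [hc']
  field_simp
  ring

/-- The first `i` reversed steps undo, up to the reflections, the last `i` original ones. -/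
theorem stepProd_reverse_aux {a b : ℕ → ℝ} (z : ℂ) {n : ℕ} (ha : ∀ j, j ≤ n → a j ≠ 0) {i : ℕ}
    (hi : i ≤ n) :
    stepProd (fun j => a (n - j)) (fun j => b (n - j + 1)) z i * reflMatrix (a n) *
      stepProd a b z n = reflMatrix (a (n - i)) * stepProd a b z (n - i) := by
  induction i with
  | zero => simp [stepProd]
  | succ i ih =>
    have h1 := ih (by omega)
    have h2 : n - i = n - (i + 1) + 1 := by omega
    rw [h2, stepProd, ← h2] at h1
    rw [stepProd, Matrix.mul_assoc, Matrix.mul_assoc, ← Matrix.mul_assoc (stepProd _ _ z i), h1,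
      ← Matrix.mul_assoc, ← Matrix.mul_assoc, ← h2,
      stepMatrix_mul_reflMatrix_mul (ha _ (by omega))]

/-- Up to the reflections, the transfer matrix of the reversed coefficients is the inverse of the
original one. -/
theorem stepProd_reverse {a b : ℕ → ℝ} (z : ℂ) {n : ℕ} (ha : ∀ j, j ≤ n → a j ≠ 0)
    (h0 : a 0 = a n) :
    stepProd (fun j => a (n - j)) (fun j => b (n - j + 1)) z n * reflMatrix (a n) *
      stepProd a b z n = reflMatrix (a n) := by
  rw [stepProd_reverse_aux z ha le_rfl, Nat.sub_self, h0, stepProd, mul_one]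

/-! ### The quadratic form of the fixed points -/

/-- The determinant of the matrix with columns `u`, `v`; it vanishes exactly when they are
proportional, that is, when they represent the same point of the projective line. -/
def wedge (u v : Fin 2 → ℂ) : ℂ := u 0 * v 1 - u 1 * v 0

theorem wedge_mulVec (T : Matrix (Fin 2) (Fin 2) ℂ) (u v : Fin 2 → ℂ) :
    wedge (T *ᵥ u) (T *ᵥ v) = T.det * wedge u v := by
  simp [wedge, mulVec, dotProduct, Fin.sum_univ_two, det_fin_two]
  ring

theorem wedge_smul_left (c : ℂ) (u v : Fin 2 → ℂ) : wedge (c • u) v = c * wedge u v := by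
  simp [wedge]; ring

theorem wedge_smul_right (c : ℂ) (u v : Fin 2 → ℂ) : wedge u (c • v) = c * wedge u v := by
  simp [wedge]; ring

theorem wedge_self (u : Fin 2 → ℂ) : wedge u u = 0 := by simp [wedge]; ring

theorem exists_conjTransfer_eq_map (n : ℕ) (a b : ℕ → ℝ) :
    ∃ T : Matrix (Fin 2) (Fin 2) ℝ[X], ∀ z : ℂ,
      conjTransfer n a b z = T.map fun P => aeval z P := by
  refine ⟨!![firstKind a b n, secondKind a b n;
    -C (a n) * firstKind a b (n - 1), -C (a n) * secondKind a b (n - 1)], fun z => ?_⟩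
  ext i j
  fin_cases i <;> fin_cases j <;> simp [conjTransfer]

/-- The form `v ↦ wedge (T v) (N T v)`, whose zeros are the fixed points of `T⁻¹ N T`, is a binary
quadratic form with polynomial coefficients. -/
theorem exists_fixedForm (T N : Matrix (Fin 2) (Fin 2) ℝ[X]) :
    ∃ P Q R : ℝ[X], ∀ (z : ℂ) (v : Fin 2 → ℂ),
      wedge ((T.map fun P => aeval z P) *ᵥ v)
        ((N.map fun P => aeval z P) *ᵥ ((T.map fun P => aeval z P) *ᵥ v)) =
      aeval z P * v 0 ^ 2 + aeval z Q * (v 0 * v 1) + aeval z R * v 1 ^ 2 := by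
  refine ⟨N 1 0 * T 0 0 ^ 2 + (N 1 1 - N 0 0) * T 0 0 * T 1 0 - N 0 1 * T 1 0 ^ 2,
    2 * N 1 0 * T 0 0 * T 0 1 + (N 1 1 - N 0 0) * (T 0 0 * T 1 1 + T 0 1 * T 1 0) -
      2 * N 0 1 * T 1 0 * T 1 1,
    N 1 0 * T 0 1 ^ 2 + (N 1 1 - N 0 0) * T 0 1 * T 1 1 - N 0 1 * T 1 1 ^ 2, fun z v => ?_⟩
  simp only [wedge, mulVec, dotProduct, Fin.sum_univ_two, map_apply, map_add, map_sub, map_mul,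
    map_pow, map_ofNat]
  ring

/-- The two quadratic equations of an irrational `M` are proportional, so that the second root of
the given one is also the second zero of the form. -/
theorem fixedForm_eq_mul {A B : ℕ → ℝ} (hA : ∀ j, 1 ≤ j → 0 < A j) {M Mt : ℂ → ℂ}
    {g : ℂ → ℕ → ℂ} (hg : ∀ z ∈ upperPlane, IsStripping A B z (g z))
    (hgM : ∀ z ∈ upperPlane, g z 0 = M z) {a₂ a₁ a₀ P Q R : ℝ[X]}
    (hM : ∀ z ∈ upperPlane, aeval z a₂ * M z ^ 2 + aeval z a₁ * M z + aeval z a₀ = 0)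
    (hMt : ∀ z ∈ upperPlane, aeval z a₂ ≠ 0 → ∀ y : ℂ,
      aeval z a₂ * y ^ 2 + aeval z a₁ * y + aeval z a₀ = aeval z a₂ * ((y - M z) * (y - Mt z)))
    (hP : ∀ z ∈ upperPlane, aeval z P * M z ^ 2 + aeval z Q * M z + aeval z R = 0)
    {z : ℂ} (hz : z ∈ upperPlane) (hz2 : aeval z a₂ ≠ 0) (v : Fin 2 → ℂ) :
    aeval z P * v 0 ^ 2 + aeval z Q * (v 0 * v 1) + aeval z R * v 1 ^ 2 =
      aeval z P * ((v 0 - M z * v 1) * (v 0 - Mt z * v 1)) := by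
  have h1 := eq_zero_of_linear_relation hA hg (E := a₂ * Q - P * a₁) (F := a₂ * R - P * a₀)
    fun z hz => by
      simp only [hgM z hz, map_sub, map_mul]
      linear_combination aeval z a₂ * hP z hz - aeval z P * hM z hz
  have hQ := congrArg (aeval z) h1.1
  have hR := congrArg (aeval z) h1.2
  simp only [map_sub, map_mul, map_zero] at hQ hR
  have h0 := hMt z hz hz2 0
  have h2 := hMt z hz hz2 1
  apply mul_left_cancel₀ hz2
  linear_combination v 0 * v 1 * hQ + v 1 ^ 2 * hR + aeval z P * v 0 * v 1 * (h2 - h0) +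
    aeval z P * v 1 ^ 2 * h0

/-- The constant coefficient does not vanish either, because `M` is not rational. -/
theorem constCoeff_ne_zero {A B : ℕ → ℝ} (hA : ∀ j, 1 ≤ j → 0 < A j) {M : ℂ → ℂ}
    {g : ℂ → ℕ → ℂ} (hg : ∀ z ∈ upperPlane, IsStripping A B z (g z))
    (hgM : ∀ z ∈ upperPlane, g z 0 = M z) {a₂ a₁ a₀ : ℝ[X]} (h2 : a₂ ≠ 0)
    (hM : ∀ z ∈ upperPlane, aeval z a₂ * M z ^ 2 + aeval z a₁ * M z + aeval z a₀ = 0) :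
    a₀ ≠ 0 := by
  rintro rfl
  refine h2 (eq_zero_of_linear_relation hA hg (E := a₂) (F := a₁) fun z hz => ?_).1
  have h := hM z hz
  rw [map_zero, ← hgM z hz] at h
  refine (mul_eq_zero.1 ?_).resolve_left ((hg z hz).ne_zero 0)
  linear_combination h

/-- The relation `T₃ = E T₁⁻¹ E` on vectors: the reflection of `T₃ X` is mapped by `T₁` to the
reflection of `X`. -/
theorem mulVec_reflect {T₁ T₃ E : Matrix (Fin 2) (Fin 2) ℂ} (hE : E * E = 1)
    (h : T₃ * E * T₁ = E) (X : Fin 2 → ℂ) : T₁ *ᵥ (E *ᵥ (T₃ *ᵥ X)) = E *ᵥ X := by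
  have h1 : T₃ * (E * T₁ * E) = 1 := by rw [← Matrix.mul_assoc, ← Matrix.mul_assoc, h, hE]
  have h2 : T₁ * E * T₃ = E := by
    calc T₁ * E * T₃ = E * E * (T₁ * E * T₃) := by rw [hE, one_mul]
      _ = E * (E * T₁ * E * T₃) := by simp only [Matrix.mul_assoc]
      _ = E := by rw [mul_eq_one_comm.1 h1, mul_one]
  rw [mulVec_mulVec, mulVec_mulVec, h2]

/-- With `R = E N⁻¹ E`, a vector is an eigenvector of `R` exactly when its reflection is one of
`N`. -/
theorem wedge_reflect {N R E : Matrix (Fin 2) (Fin 2) ℂ} (hE : E * E = 1) (hEdet : E.det = -1)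
    (hR : R.det = 1) (h : R * E * N = E) (X : Fin 2 → ℂ) :
    wedge (E *ᵥ X) (N *ᵥ (E *ᵥ X)) = -wedge (R *ᵥ X) X := by
  have h1 := wedge_mulVec E (E *ᵥ X) (N *ᵥ (E *ᵥ X))
  have h2 := wedge_mulVec R X (E *ᵥ (N *ᵥ (E *ᵥ X)))
  have h3 : R *ᵥ (E *ᵥ (N *ᵥ (E *ᵥ X))) = X := by
    simp only [mulVec_mulVec, ← Matrix.mul_assoc]
    rw [h, hE, one_mulVec]
  rw [mulVec_mulVec, hE, one_mulVec, hEdet] at h1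
  rw [h3, hR] at h2
  linear_combination h1 + h2

theorem mul_mul_ne_one_of_im_pos {r : ℝ} (hr : 0 < r) {x y : ℂ} (hx : 0 < x.im) (hy : 0 < y.im) :
    (r : ℂ) * x * y ≠ 1 := by
  intro h
  have h1 : y = ((r : ℂ) * x)⁻¹ := eq_inv_of_mul_eq_one_right h
  rw [h1, Complex.inv_im, Complex.im_ofReal_mul] at hy
  exact absurd hy (not_lt.2
    (div_nonpos_of_nonpos_of_nonneg (by nlinarith) (Complex.normSq_nonneg _)))

theorem fracLin_eq_of_mulVec {T : Matrix (Fin 2) (Fin 2) ℂ} {w μ : ℂ} {V : Fin 2 → ℂ} (hμ : μ ≠ 0)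
    (h : T *ᵥ ![w, 1] = μ • V) : fracLin T w = V 0 / V 1 := by
  have h0 := congrFun h 0
  have h1 := congrFun h 1
  simp [mulVec, dotProduct, Fin.sum_univ_two] at h0 h1
  rw [fracLin, h0, h1, mul_div_mul_left _ _ hμ]

/-! ### Palindromes -/

theorem palindrome_map_range {n : ℕ} {f : ℕ → ℝ} :
    ((List.range n).map f).Palindrome ↔ ∀ i < n, f i = f (n - 1 - i) := by
  constructor
  · intro h i hi
    have h1 := h.reverse_eq
    have h2 := List.getElem_of_eq h1 (i := i) (by simpa using hi)
    simpa [List.getElem_reverse] using h2.symm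
  · intro h
    refine List.Palindrome.of_reverse_eq (List.ext_getElem (by simp) fun i h1 h2 => ?_)
    simpa [List.getElem_reverse] using (h i (by simpa using h2)).symm

theorem isTwoPalindromes_firstTerms {p s : ℕ} (hs : s ≤ p) (u : ℕ → ℝ) :
    IsTwoPalindromes (firstTerms p u) s (p - s) ↔
      (∀ i < s, u (i + 1) = u (s - i)) ∧ ∀ i < p - s, u (s + i + 1) = u (p - i) := by
  have hsplit : firstTerms p u = (List.range s).map (fun j => u (j + 1)) ++
      (List.range (p - s)).map (fun j => u (s + j + 1)) := by
    conv_lhs => rw [firstTerms, ← Nat.add_sub_of_le hs, List.range_add]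
    simp [Function.comp_def]
  have h1 : IsTwoPalindromes (firstTerms p u) s (p - s) ↔
      ((List.range s).map (fun j => u (j + 1))).Palindrome ∧
        ((List.range (p - s)).map (fun j => u (s + j + 1))).Palindrome := by
    constructor
    · rintro ⟨x, y, h, hx, hy, hxl, -⟩
      rw [hsplit] at h
      obtain ⟨rfl, rfl⟩ := List.append_inj h (by simp [hxl])
      exact ⟨hx, hy⟩
    · rintro ⟨hx, hy⟩
      exact ⟨_, _, hsplit, hx, hy, by simp, by simp⟩
  rw [h1, palindrome_map_range, palindrome_map_range]
  refine and_congr (forall₂_congr fun i hi => ?_) (forall₂_congr fun i hi => ?_)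
  · rw [show s - 1 - i + 1 = s - i by omega]
  · rw [show s + (p - s - 1 - i) + 1 = p - i by omega]

theorem eq_of_modEq_of_periodic {p : ℕ} {u : ℕ → ℝ} (hu : ∀ j, 1 ≤ j → u (j + p) = u j) {i j : ℕ}
    (hi : 1 ≤ i) (hj : 1 ≤ j) (h : i ≡ j [MOD p]) : u i = u j := by
  wlog hij : i ≤ j generalizing i j
  · exact (this hj hi h.symm (by omega)).symm
  obtain ⟨t, ht⟩ := (Nat.modEq_iff_dvd' hij).1 h
  obtain rfl : j = i + p * t := by omega
  clear ht hij h hj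
  induction t with
  | zero => rfl
  | succ t ih => rw [ih, ← hu _ (by omega)]; congr 1; ring

/-- For a periodic sequence, being a concatenation of two palindromes is invariance under a
reflection of the index modulo the period. -/
theorem isTwoPalindromes_iff_reflection {p s : ℕ} (hs : s < p) {u : ℕ → ℝ}
    (hu : ∀ j, 1 ≤ j → u (j + p) = u j) :
    IsTwoPalindromes (firstTerms p u) s (p - s) ↔
      ∀ i j, 1 ≤ i → 1 ≤ j → i + j ≡ s + 1 [MOD p] → u i = u j := by
  rw [isTwoPalindromes_firstTerms hs.le]
  constructor
  · rintro ⟨h1, h2⟩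
    -- reduction to indices between `1` and `p`
    have hred : ∀ i, 1 ≤ i → ∃ i', 1 ≤ i' ∧ i' ≤ p ∧ i ≡ i' [MOD p] := by
      intro i hi
      refine ⟨(i - 1) % p + 1, by omega, Nat.mod_lt _ (by omega), ?_⟩
      have := (Nat.mod_modEq (i - 1) p).symm.add_right 1
      rwa [Nat.sub_add_cancel hi] at this
    intro i j hi hj h
    obtain ⟨i', hi1, hip, hi'⟩ := hred i hi
    obtain ⟨j', hj1, hjp, hj'⟩ := hred j hj
    rw [eq_of_modEq_of_periodic hu hi hi1 hi', eq_of_modEq_of_periodic hu hj hj1 hj']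
    have h3 : i' + j' ≡ s + 1 [MOD p] := ((hi'.add hj').symm.trans h)
    have h4 : i' + j' = s + 1 ∨ i' + j' = s + 1 + p := by
      rcases le_total (s + 1) (i' + j') with hle | hle
      · obtain ⟨t, ht⟩ := (Nat.modEq_iff_dvd' hle).1 h3.symm
        have : t < 2 := by
          by_contra! ht2
          have := Nat.mul_le_mul_left p ht2
          omega
        interval_cases t <;> omega
      · obtain ⟨t, ht⟩ := (Nat.modEq_iff_dvd' hle).1 h3
        have : t < 1 := by
          by_contra! ht2
          have := Nat.mul_le_mul_left p ht2
          omega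
        interval_cases t
        omega
    rcases h4 with h4 | h4
    · have := h1 (i' - 1) (by omega)
      rwa [show i' - 1 + 1 = i' by omega, show s - (i' - 1) = j' by omega] at this
    · have := h2 (i' - s - 1) (by omega)
      rwa [show s + (i' - s - 1) + 1 = i' by omega, show p - (i' - s - 1) = j' by omega] at this
  · intro h
    refine ⟨fun i hi => h _ _ (by omega) (by omega) ?_, fun i hi => h _ _ (by omega) (by omega) ?_⟩
    · rw [show i + 1 + (s - i) = s + 1 by omega]
    · rw [show s + i + 1 + (p - i) = s + 1 + p by omega]
      simp [Nat.ModEq]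

/-! ### The reflection identity at a single point -/

/-- For the vector `V = T₃ (x, 1)`, the equation `Mt = V₁ / (c² V₀)`, with the denominator cleared,
holds exactly when `(x, 1)` is an eigenvector of the transfer matrix `R` of the reversed period. The
zero `M` of the form is excluded because its image `m` under `T₁` would be the reflection
`1 / (c² x)` of `x`, while `m` and `x` both lie in the upper half-plane. -/
theorem wedge_eq_zero_iff_reflection {c : ℝ} (hc : 0 < c) {T₁ T₃ R N : Matrix (Fin 2) (Fin 2) ℂ}
    {M Mt P m x μ : ℂ} (hm : 0 < m.im) (hx : 0 < x.im) (hμ : μ ≠ 0) (hP : P ≠ 0)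
    (hT₁ : T₁.det = 1) (hR : R.det = 1)
    (hT : T₃ * reflMatrix c * T₁ = reflMatrix c) (hN : R * reflMatrix c * N = reflMatrix c)
    (hM : T₁ *ᵥ ![M, 1] = μ • ![m, 1])
    (hform : ∀ v : Fin 2 → ℂ, wedge (T₁ *ᵥ v) (N *ᵥ (T₁ *ᵥ v)) =
      P * ((v 0 - M * v 1) * (v 0 - Mt * v 1))) :
    wedge (R *ᵥ ![x, 1]) ![x, 1] = 0 ↔
      (c : ℂ) ^ 2 * Mt * (T₃ *ᵥ ![x, 1]) 0 = (T₃ *ᵥ ![x, 1]) 1 := by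
  have hc' : (c : ℂ) ≠ 0 := by exact_mod_cast hc.ne'
  set V := T₃ *ᵥ ![x, 1] with hV
  have hE := reflMatrix_mul_self hc.ne'
  have hTY : T₁ *ᵥ (reflMatrix c *ᵥ V) = reflMatrix c *ᵥ ![x, 1] := mulVec_reflect hE hT _
  have h1 := hform (reflMatrix c *ᵥ V)
  rw [hTY, wedge_reflect hE (det_reflMatrix hc.ne') hR hN] at h1
  have hY0 : (reflMatrix c *ᵥ V) 0 = V 1 / c := by
    simp [reflMatrix, mulVec, dotProduct, Fin.sum_univ_two, div_eq_inv_mul]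
  have hY1 : (reflMatrix c *ᵥ V) 1 = c * V 0 := by
    simp [reflMatrix, mulVec, dotProduct, Fin.sum_univ_two]
  have hne : V 1 / c - M * (c * V 0) ≠ 0 := by
    have h2 := wedge_mulVec T₁ (reflMatrix c *ᵥ V) ![M, 1]
    rw [hTY, hM, wedge_smul_right, hT₁, one_mul] at h2
    have h3 : wedge (reflMatrix c *ᵥ V) ![M, 1] = V 1 / c - M * (c * V 0) := by
      simp only [wedge, hY0, hY1, cons_val_zero, cons_val_one]
      ring
    rw [← h3, ← h2]
    refine mul_ne_zero hμ fun h4 => ?_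
    have h5 : 1 / (c : ℂ) - c * x * m = 0 := by
      simpa [wedge, reflMatrix, mulVec, dotProduct, Fin.sum_univ_two] using h4
    refine mul_mul_ne_one_of_im_pos (pow_pos hc 2) hx hm ?_
    field_simp at h5
    push_cast
    linear_combination -h5
  rw [hY0, hY1] at h1
  have h6 : wedge (R *ᵥ ![x, 1]) ![x, 1] = 0 ↔ V 1 / c - Mt * (c * V 0) = 0 := by
    rw [← neg_eq_zero, h1]
    simp [hP, hne]
  rw [h6]
  constructor
  · intro h
    field_simp at h
    linear_combination -h
  · intro h
    field_simp
    linear_combination -h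

theorem one_div_eq_div_of_mul_eq {r V₀ V₁ : ℂ} (hV : V₀ ≠ 0 ∨ V₁ ≠ 0) (h : r * V₀ = V₁) :
    1 / r = V₀ / V₁ := by
  have hV0 : V₀ ≠ 0 := by
    rintro rfl
    simp at h
    simp [← h] at hV
  rw [← h, div_mul_cancel_right₀ hV0, one_div]

theorem mul_eq_of_one_div_eq_div {r V₀ V₁ : ℂ} (hr : r ≠ 0) (h : 1 / r = V₀ / V₁) :
    r * V₀ = V₁ := by
  have hV1 : V₁ ≠ 0 := by
    rintro rfl
    simp [hr] at h
  field_simp at h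
  exact h.symm

theorem mulVec_ne_zero_of_det {T : Matrix (Fin 2) (Fin 2) ℂ} (hT : T.det = 1) (x : ℂ) :
    (T *ᵥ ![x, 1]) 0 ≠ 0 ∨ (T *ᵥ ![x, 1]) 1 ≠ 0 := by
  by_contra! h
  have h1 := wedge_mulVec T ![x, 1] ![1, 0]
  simp [wedge, hT, h.1, h.2] at h1

/-- The form does not vanish identically at any point: one period maps some point of the upper
half-plane to `0`. -/
theorem exists_fixedForm_ne_zero {a b : ℕ → ℝ} {p : ℕ} (hp : 1 ≤ p) {z : ℂ} (hz : 0 < z.im)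
    (ha : ∀ j, 1 ≤ j → j ≤ p → a j ≠ 0) {T : Matrix (Fin 2) (Fin 2) ℂ} (hT : T.det = 1) :
    ∃ v : Fin 2 → ℂ, wedge (T *ᵥ v) (stepProd a b z p *ᵥ (T *ᵥ v)) ≠ 0 := by
  obtain ⟨μ, hμ, h⟩ := stepProd_mulVec_unstrip (b := b) (w := 0) hz le_rfl ha
  refine ⟨T⁻¹ *ᵥ ![unstrip a b z p 0 0, 1], ?_⟩
  rw [mulVec_mulVec, mul_nonsing_inv _ (by simp [hT]), one_mulVec, h, wedge_smul_right]
  refine mul_ne_zero hμ ?_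
  have h1 : 0 < (unstrip a b z p 0 0).im := by
    obtain ⟨q, rfl⟩ : ∃ q, p = q + 1 := ⟨p - 1, by omega⟩
    exact unstrip_succ_im_pos hz le_rfl q 0
  intro h2
  simp [wedge] at h2
  simp [h2] at h1

/-- An eigenvector `(x, 1)` of the transfer matrix of one period gives a value `x` reproduced by
the continued fraction. -/
theorem unstrip_eq_self_of_wedge {a b : ℕ → ℝ} {p : ℕ} {z x : ℂ} (hz : 0 < z.im) (hx : 0 < x.im)
    (ha : ∀ j, 1 ≤ j → j ≤ p → a j ≠ 0)
    (h : wedge (stepProd a b z p *ᵥ ![x, 1]) ![x, 1] = 0) : unstrip a b z p 0 x = x := by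
  obtain ⟨μ, -, h1⟩ := stepProd_mulVec_unstrip (b := b) hz hx.le ha
  have h2 := wedge_mulVec (stepProd a b z p) ![x, 1] ![unstrip a b z p 0 x, 1]
  rw [h1, wedge_smul_right, h, mul_zero, det_stepProd z ha, one_mul] at h2
  simp [wedge] at h2
  linear_combination h2

/-! ### Eventually periodic continued fractions -/

theorem prependSeq_add (k : ℕ) (u v : ℕ → ℝ) {j : ℕ} (hj : 1 ≤ j) :
    prependSeq k u v (k + j) = v j := by
  rw [prependSeq, if_neg (by omega), Nat.add_sub_cancel_left]

theorem prependSeq_of_le {k : ℕ} (u v : ℕ → ℝ) {j : ℕ} (hj : j ≤ k) :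
    prependSeq k u v j = u j := if_pos hj

/-- The successively stripped functions of an m-function with eventually periodic coefficients. -/
theorem exists_isStripping_periodic {M : ℂ → ℂ} {k p : ℕ} {α β a b : ℕ → ℝ}
    (hper : ∀ j, 1 ≤ j → a (j + p) = a j ∧ b (j + p) = b j)
    (hcf : HasCFCoefficients M (prependSeq k α a) (prependSeq k β b)) :
    ∃ g : ℂ → ℕ → ℂ, ∀ z ∈ upperPlane, g z 0 = M z ∧
      IsStripping (prependSeq k α a) (prependSeq k β b) z (g z) ∧
      ∀ j, g z (k + (j + p)) = g z (k + j) := by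
  have h : ∀ z, ∃ g : ℕ → ℂ, z ∈ upperPlane → g 0 = M z ∧
      IsStripping (prependSeq k α a) (prependSeq k β b) z g ∧
      ∀ j, g (k + (j + p)) = g (k + j) := by
    intro z
    by_cases hz : z ∈ upperPlane
    · obtain ⟨g, h0, hg, hlim⟩ := exists_isStripping hcf.pos hz
        ((hcf.tendsto z hz).congr fun n => jacobiFraction_convs' n)
      refine ⟨g, fun _ => ⟨h0, hg, fun j => ?_⟩⟩
      refine tendsto_nhds_unique ((hlim (k + (j + p))).congr fun n => ?_) (hlim (k + j))
      refine unstrip_congr (fun s hs => ?_) n 0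
      simp only [Nat.add_assoc]
      simp only [prependSeq_add _ _ _ (show 1 ≤ j + s by omega),
        prependSeq_add _ _ _ (show 1 ≤ j + (p + s) by omega)]
      rw [← (hper (j + s) (by omega)).1, ← (hper (j + s) (by omega)).2,
        show j + s + p = j + (p + s) by omega]
      exact ⟨rfl, rfl⟩
    · exact ⟨0, fun h => absurd h hz⟩
  choose g hg using h
  exact ⟨g, hg⟩

theorem aeval_ne_zero_mem_codiscreteWithin {P : ℝ[X]} (hP : P ≠ 0) (U : Set ℂ) :
    {z : ℂ | aeval z P ≠ 0} ∈ codiscreteWithin U := by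
  refine mem_of_superset (compl_finite_mem_codiscreteWithin (P.rootSet_finite ℂ)) fun z hz h => ?_
  exact hz (mem_rootSet.2 ⟨hP, h⟩)

/-- A property that holds off a discrete subset of the upper half-plane holds along a sequence of
points whose imaginary parts tend to infinity. -/
theorem exists_seq_of_mem_codiscreteWithin {S : Set ℂ} (hS : S ∈ codiscreteWithin upperPlane) :
    ∃ z : ℕ → ℂ, (∀ n, z n ∈ S ∧ 0 < (z n).im) ∧ Tendsto (fun n => (z n).im) atTop atTop := by
  have h : ∀ n : ℕ, ∃ z : ℂ, z ∈ S ∧ (n : ℝ) < z.im := by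
    intro n
    have h0 : ((n : ℂ) + 1) * Complex.I ∈ upperPlane := by simp [upperPlane]; positivity
    have h1 := mem_codiscreteWithin_iff_forall_mem_nhdsNE.1 hS _ h0
    have h2 : {z : ℂ | (n : ℝ) < z.im} ∈ 𝓝 (((n : ℂ) + 1) * Complex.I) :=
      (isOpen_lt continuous_const Complex.continuous_im).mem_nhds (by simp)
    obtain ⟨z, hz1, hz2⟩ :=
      Filter.nonempty_of_mem (Filter.inter_mem h1 (mem_nhdsWithin_of_mem_nhds h2))
    have hz2' : (n : ℝ) < z.im := hz2
    exact ⟨z, hz1.resolve_right fun h => h (show 0 < z.im from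
      (Nat.cast_nonneg n).trans_lt hz2'), hz2'⟩
  choose z hz using h
  exact ⟨z, fun n => ⟨(hz n).1, (Nat.cast_nonneg n).trans_lt (hz n).2⟩,
    tendsto_atTop_mono (fun n => (hz n).2.le) tendsto_natCast_atTop_atTop⟩

/-! ### Reversed periodic sequences -/

/-- In terms of the reversed sequences `j ↦ a_{pj - j}`, `j ↦ b_{pj - j + 1}`, in which `p * j`
only serves to represent `-j` modulo the period by a positive index, a doubly palindromic sequence
is one that agrees from the index `l + 2` on with its reversal. -/
theorem doublyPalindromic_iff {p l : ℕ} {a b : ℕ → ℝ} (hlp : l < p - 1)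
    (hper : ∀ j, 1 ≤ j → a (j + p) = a j ∧ b (j + p) = b j) :
    DoublyPalindromic p l a b ↔
      ∀ j, 1 ≤ j → a (l + 1 + j) = a (p * j - j) ∧ b (l + 1 + j) = b (p * j - j + 1) := by
  have hpj : ∀ j, 1 ≤ j → j < p * j := fun j hj => by nlinarith [show 2 ≤ p by omega]
  have ha := fun j hj => (hper j hj).1
  have hb := fun j hj => (hper j hj).2
  have h1 : DoublyPalindromic p l a b ↔
      (∀ i j, 1 ≤ i → 1 ≤ j → i + j ≡ l + 1 [MOD p] → a i = a j) ∧
      (∀ i j, 1 ≤ i → 1 ≤ j → i + j ≡ l + 1 + 1 [MOD p] → b i = b j) := by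
    rw [← isTwoPalindromes_iff_reflection (by omega) ha,
      ← isTwoPalindromes_iff_reflection (by omega) hb, ← Nat.sub_sub]
    exact ⟨fun h => ⟨h.left, h.right⟩, fun h => ⟨hper, h.1, h.2⟩⟩
  rw [h1]
  constructor
  · rintro ⟨h2, h3⟩ j hj
    have := hpj j hj
    refine ⟨h2 _ _ (by omega) (by omega) ?_, h3 _ _ (by omega) (by omega) ?_⟩
    · rw [show l + 1 + j + (p * j - j) = l + 1 + p * j by omega]
      simp [Nat.ModEq]
    · rw [show l + 1 + j + (p * j - j + 1) = l + 1 + 1 + p * j by omega]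
      simp [Nat.ModEq]
  · intro h
    -- a representative of `i` modulo `p` that is at least `l + 2`
    have hrep : ∀ i, 1 ≤ i → ∃ j, 1 ≤ j ∧ l + 1 + j ≡ i [MOD p] := by
      intro i hi
      refine ⟨p * (l + 1) - (l + 1) + i, by omega, ?_⟩
      have := hpj (l + 1) (by omega)
      rw [show l + 1 + (p * (l + 1) - (l + 1) + i) = i + p * (l + 1) by omega]
      simp [Nat.ModEq]
    have hmod : ∀ {s i i' j : ℕ}, 1 ≤ j → l + 1 + j ≡ i [MOD p] → i + i' ≡ l + 1 + s [MOD p] →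
        p * j - j + s ≡ i' [MOD p] := by
      intro s i i' j hj h1 h2
      have := hpj j hj
      refine Nat.ModEq.add_left_cancel' (l + 1 + j) ?_
      refine Nat.ModEq.trans ?_ ((h1.add_right i').trans h2).symm
      rw [show l + 1 + j + (p * j - j + s) = l + 1 + s + p * j by omega]
      simp [Nat.ModEq]
    refine ⟨fun i i' hi hi' hii => ?_, fun i i' hi hi' hii => ?_⟩
    all_goals
      obtain ⟨j, hj, hji⟩ := hrep i hi
      have hlt := hpj j hj
    · rw [← eq_of_modEq_of_periodic ha (by omega) hi hji, (h j hj).1]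
      exact eq_of_modEq_of_periodic ha (by omega) hi' (hmod (s := 0) hj hji hii)
    · rw [← eq_of_modEq_of_periodic hb (by omega) hi hji, (h j hj).2]
      exact eq_of_modEq_of_periodic hb (by omega) hi' (hmod (s := 1) hj hji hii)

theorem reversed_periodic {p : ℕ} {a b : ℕ → ℝ} (hp : 2 ≤ p)
    (hper : ∀ j, 1 ≤ j → a (j + p) = a j ∧ b (j + p) = b j) :
    ∀ j, 1 ≤ j → a (p * (j + p) - (j + p)) = a (p * j - j) ∧
      b (p * (j + p) - (j + p) + 1) = b (p * j - j + 1) := by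
  have hpj : ∀ j, 1 ≤ j → j < p * j := fun j hj => by nlinarith
  intro j hj
  have h1 := hpj j hj
  have h2 : p * (j + p) - (j + p) ≡ p * j - j [MOD p] := by
    have h3 := hpj p (by omega)
    rw [show p * (j + p) - (j + p) = p * j - j + (p * p - p) by rw [mul_add]; omega,
      show p * p - p = p * (p - 1) by rw [Nat.mul_sub, mul_one]]
    simp [Nat.ModEq]
  have h4 := hpj (j + p) (by omega)
  exact ⟨eq_of_modEq_of_periodic (fun j hj => (hper j hj).1) (by omega) (by omega) h2,
    eq_of_modEq_of_periodic (fun j hj => (hper j hj).2) (by omega) (by omega) (h2.add_right 1)⟩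

/-- The transfer matrix of one period of the reversed sequences is, up to the reflections, the
inverse of that of a period of the original ones. -/
theorem stepProd_reverse_period {p : ℕ} {a b : ℕ → ℝ} (hp : 2 ≤ p)
    (hper : ∀ j, 1 ≤ j → a (j + p) = a j ∧ b (j + p) = b j) (hapos : ∀ j, 1 ≤ j → 0 < a j)
    (z : ℂ) :
    stepProd (fun j => a (p * j - j)) (fun j => b (p * j - j + 1)) z p * reflMatrix (a p) *
      stepProd a b z p = reflMatrix (a p) := by
  have hpj : ∀ j, 1 ≤ j → j < p * j := fun j hj => by nlinarith
  -- the value `a 0` is arbitrary, and is replaced by the one that periodicity suggests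
  set a' : ℕ → ℝ := Function.update a 0 (a p) with ha'
  have hp0 : p ≠ 0 := by omega
  have h1 := stepProd_reverse (a := a') (b := b) z (n := p) (fun j hj => ?_) ?_
  · have h2 : a' p = a p := by rw [ha', Function.update_of_ne hp0]
    rw [h2] at h1
    rw [stepProd_congr (a' := fun j => a' (p - j)) (b' := fun j => b (p - j + 1)) z
      fun j h1 hj => ?_, stepProd_congr (a := a) (a' := a') (b' := b) z fun j h1 _ => ?_]
    · exact h1
    · simp [ha', show j ≠ 0 by omega]
    · have h3 := hpj j h1
      have hmod : ∀ s, 1 ≤ p - j + s → p * j - j + s ≡ p - j + s [MOD p] := by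
        intro s _
        obtain ⟨i, rfl⟩ : ∃ i, j = i + 1 := ⟨j - 1, by omega⟩
        rw [show p * (i + 1) - (i + 1) + s = p - (i + 1) + s + p * i by
          rw [mul_add, mul_one] at h3 ⊢; omega]
        simp [Nat.ModEq]
      refine ⟨?_, eq_of_modEq_of_periodic (fun j hj => (hper j hj).2) (by omega) (by omega)
        (hmod 1 (by omega))⟩
      rcases Nat.eq_zero_or_pos (p - j) with h0 | h0
      · simp only [h0, ha', Function.update_self]
        obtain rfl : j = p := by omega
        refine eq_of_modEq_of_periodic (fun j hj => (hper j hj).1) (by omega) (by omega) ?_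
        rw [show j * j - j = j * (j - 1) by rw [Nat.mul_sub, mul_one]]
        simp [Nat.ModEq]
      · simp only [ha', Function.update_of_ne h0.ne']
        exact eq_of_modEq_of_periodic (fun j hj => (hper j hj).1) (by omega) h0
          (hmod 0 (by omega))
  · rcases Nat.eq_zero_or_pos j with rfl | hj0
    · simp [ha', (hapos p (by omega)).ne']
    · rw [ha', Function.update_of_ne hj0.ne']
      exact (hapos j hj0).ne'
  · simp [ha', hp0]

/-! ### Characterization of doubly palindromic sequences -/

theorem theorem2
    (M Mt : ℂ → ℂ) (k p l : ℕ) (α β a b : ℕ → ℝ)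
    (hk : 1 ≤ k) (hl : 1 ≤ l) (hlp : l < p - 1)
    -- `a` and `b` are `p`-periodic
    (hper : ∀ j, 1 ≤ j → a (j + p) = a j ∧ b (j + p) = b j)
    -- the normalization of the last non-periodic coefficients
    (hkp : α k = a p ∧ β k = b p)
    (hM : IsDiscreteMFunction M)
    -- the coefficients of `M` are `α₁, …, α_k, a₁, a₂, …` and `β₁, …, β_k, b₁, b₂, …`
    (hcf : HasCFCoefficients M (prependSeq k α a) (prependSeq k β b))
    (hMt : IsSecondSolution M Mt)
    -- the convention `α₀ = α_k`, used in the reversed sequence `α_{k-1}, …, α₁, α₀`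
    (hα0 : α 0 = α k) :
    DoublyPalindromic p l a b ↔
      -- an identity of meromorphic functions on the upper half-plane
      (fun z => 1 / ((α k : ℂ) ^ 2 * Mt z)) =ᶠ[codiscreteWithin upperPlane]
        fun z => fracLin
          (conjTransfer k (fun j => α (k - j)) (fun j => β (k - j + 1)) z *
            conjTransfer (l + 1) a b z * conjTransfer k α β z) (M z) := by
  obtain ⟨a₂, a₁, a₀, ha₂, hMquad, hMtquad⟩ := hMt
  obtain ⟨g, hg⟩ := exists_isStripping_periodic hper hcf
  have hpj : ∀ j, 1 ≤ j → j < p * j := fun j hj => by nlinarith [show 2 ≤ p by omega]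
  have hapos : ∀ j, 1 ≤ j → 0 < a j := fun j hj => by
    rw [← prependSeq_add k α a hj]
    exact hcf.pos _ (by omega)
  have hαk : 0 < α k := hkp.1 ▸ hapos p (by omega)
  have hαne : ∀ j, j ≤ k → α j ≠ 0 := fun j hj => by
    rcases Nat.eq_zero_or_pos j with rfl | hj0
    · exact hα0 ▸ hαk.ne'
    · rw [← prependSeq_of_le α a hj]
      exact (hcf.pos j hj0).ne'
  have hane : ∀ j, 1 ≤ j → j ≤ p → a j ≠ 0 := fun j hj _ => (hapos j hj).ne'
  set c : ℕ → ℝ := fun j => a (p * j - j) with hc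
  set d : ℕ → ℝ := fun j => b (p * j - j + 1) with hd
  have hcpos : ∀ j, 1 ≤ j → 0 < c j := fun j hj => hapos _ (by have := hpj j hj; omega)
  have hcne : ∀ j, 1 ≤ j → j ≤ p → c j ≠ 0 := fun j hj _ => (hcpos j hj).ne'
  have hcper := reversed_periodic (show 2 ≤ p by omega) hper
  -- the periodic tail of the stripped functions
  have hm : ∀ z ∈ upperPlane, IsStripping a b z fun j => g z (k + j) := fun z hz =>
    ((hg z hz).2.1.shift k).congr fun j hj => ⟨prependSeq_add _ _ _ hj, prependSeq_add _ _ _ hj⟩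
  have hT₁ : ∀ z ∈ upperPlane, ∃ μ : ℂ, μ ≠ 0 ∧
      stepProd α β z k *ᵥ ![M z, 1] = μ • ![g z k, 1] := by
    intro z hz
    have h1 := stepProd_mulVec (n := k) (fun j hj _ => (hcf.pos j hj).ne')
      fun j _ => (hg z hz).2.1.step j
    rwa [(hg z hz).1, stepProd_congr (a' := α) (b' := β) z fun j _ hj =>
      ⟨prependSeq_of_le _ _ hj, prependSeq_of_le _ _ hj⟩] at h1
  have hT₂ : ∀ z ∈ upperPlane, ∀ i n : ℕ, ∃ μ : ℂ, μ ≠ 0 ∧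
      stepProd (fun j => a (i + j)) (fun j => b (i + j)) z n *ᵥ ![g z (k + i), 1] =
        μ • ![g z (k + (i + n)), 1] := fun z hz i n =>
    stepProd_mulVec (a := fun j => a (i + j)) (b := fun j => b (i + j))
      (g := fun j => g z (k + (i + j))) (fun j hj _ => (hapos _ (by omega)).ne')
      fun j _ => ((hm z hz).shift i).step j
  have hT : ∀ z, stepProd (fun j => α (k - j)) (fun j => β (k - j + 1)) z k * reflMatrix (α k) *
      stepProd α β z k = reflMatrix (α k) := fun z => stepProd_reverse z hαne hα0
  have hN : ∀ z, stepProd c d z p * reflMatrix (α k) * stepProd a b z p = reflMatrix (α k) := fun z =>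
    hkp.1 ▸ stepProd_reverse_period (by omega) hper hapos z
  -- the quadratic equation coming from the period
  obtain ⟨T, hTmap⟩ := exists_conjTransfer_eq_map k α β
  obtain ⟨N, hNmap⟩ := exists_conjTransfer_eq_map p a b
  obtain ⟨P, Q, R, hform⟩ := exists_fixedForm T N
  simp only [← hTmap, ← hNmap, conjTransfer_eq_stepProd _ _ _ hk,
    conjTransfer_eq_stepProd _ _ _ (show 1 ≤ p by omega)] at hform
  have hroot : ∀ z ∈ upperPlane,
      aeval z P * M z ^ 2 + aeval z Q * M z + aeval z R = 0 := by
    intro z hz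
    obtain ⟨μ, -, h1⟩ := hT₁ z hz
    obtain ⟨ν, -, h2⟩ := hT₂ z hz 0 p
    rw [(hg z hz).2.2 0] at h2
    simp only [zero_add, add_zero] at h2
    have h3 := hform z ![M z, 1]
    rw [h1, mulVec_smul, h2, wedge_smul_left, wedge_smul_right, wedge_smul_right, wedge_self] at h3
    simp at h3
    exact h3.symm
  have hfactor := fun z hz h v => fixedForm_eq_mul hcf.pos (fun z hz => (hg z hz).2.1)
    (fun z hz => (hg z hz).1) hMquad hMtquad hroot (z := z) hz h v
  have ha₀ : a₀ ≠ 0 := constCoeff_ne_zero hcf.pos (fun z hz => (hg z hz).2.1)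
    (fun z hz => (hg z hz).1) ha₂ hMquad
  set x : ℂ → ℂ := fun z => g z (k + (l + 1)) with hx
  have hdetT₁ : ∀ z, (stepProd α β z k).det = 1 := fun z =>
    det_stepProd z fun j _ hj => hαne j hj
  have hdetT₃ : ∀ z, (stepProd (fun j => α (k - j)) (fun j => β (k - j + 1)) z k).det = 1 :=
    fun z => det_stepProd z fun j _ _ => hαne _ (Nat.sub_le _ _)
  have hpoint : ∀ z ∈ upperPlane, aeval z a₂ ≠ 0 →
      (wedge (stepProd c d z p *ᵥ ![x z, 1]) ![x z, 1] = 0 ↔ (α k : ℂ) ^ 2 * Mt z *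
        (stepProd (fun j => α (k - j)) (fun j => β (k - j + 1)) z k *ᵥ ![x z, 1]) 0 =
        (stepProd (fun j => α (k - j)) (fun j => β (k - j + 1)) z k *ᵥ ![x z, 1]) 1) := by
    intro z hz h2
    obtain ⟨μ, hμ, h1⟩ := hT₁ z hz
    have hP : aeval z P ≠ 0 := by
      intro hP
      obtain ⟨v, hv⟩ := exists_fixedForm_ne_zero (b := b) (show 1 ≤ p by omega) hz hane (hdetT₁ z)
      rw [hform, hfactor z hz h2, hP, zero_mul] at hv
      exact hv rfl
    exact wedge_eq_zero_iff_reflection hαk ((hg z hz).2.1.im_pos k) ((hg z hz).2.1.im_pos _) hμ hP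
      (hdetT₁ z) (det_stepProd z hcne) (hT z) (hN z) h1
      fun v => by rw [hform, hfactor z hz h2]
  have hfrac : ∀ z ∈ upperPlane, fracLin
      (conjTransfer k (fun j => α (k - j)) (fun j => β (k - j + 1)) z *
        conjTransfer (l + 1) a b z * conjTransfer k α β z) (M z) =
      (stepProd (fun j => α (k - j)) (fun j => β (k - j + 1)) z k *ᵥ ![x z, 1]) 0 /
      (stepProd (fun j => α (k - j)) (fun j => β (k - j + 1)) z k *ᵥ ![x z, 1]) 1 := by
    intro z hz
    obtain ⟨μ, hμ, h1⟩ := hT₁ z hz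
    obtain ⟨ν, hν, h2⟩ := hT₂ z hz 0 (l + 1)
    simp only [zero_add, add_zero] at h2
    refine fracLin_eq_of_mulVec (mul_ne_zero hμ hν) ?_
    rw [conjTransfer_eq_stepProd _ _ _ hk, conjTransfer_eq_stepProd _ _ _ hk,
      conjTransfer_eq_stepProd _ _ _ (show 1 ≤ l + 1 by omega), ← mulVec_mulVec, h1, mulVec_smul,
      ← mulVec_mulVec, h2, mulVec_smul, mul_smul]
  rw [doublyPalindromic_iff hlp hper]
  constructor
  · intro h
    filter_upwards [aeval_ne_zero_mem_codiscreteWithin ha₂ upperPlane,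
      self_mem_codiscreteWithin upperPlane] with z hz2 hz
    rw [hfrac z hz]
    refine one_div_eq_div_of_mul_eq (mulVec_ne_zero_of_det (hdetT₃ z) _) ((hpoint z hz hz2).1 ?_)
    obtain ⟨μ, -, h1⟩ := hT₂ z hz (l + 1) p
    rw [stepProd_congr (a' := c) (b' := d) z fun j hj _ => h j hj, (hg z hz).2.2] at h1
    rw [h1, wedge_smul_left, wedge_self, mul_zero]
  · intro h
    obtain ⟨z, hz, hzlim⟩ := exists_seq_of_mem_codiscreteWithin (inter_mem h (inter_mem
      (aeval_ne_zero_mem_codiscreteWithin ha₂ upperPlane)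
      (aeval_ne_zero_mem_codiscreteWithin ha₀ upperPlane)))
    have hrev : ∀ n, ∃ y : ℕ → ℂ, y 0 = x (z n) ∧ IsStripping c d (z n) y := by
      intro n
      obtain ⟨⟨h1, h2, h3⟩, hzn⟩ := hz n
      have hMt0 : Mt (z n) ≠ 0 := by
        intro h0
        have h4 := hMtquad (z n) hzn h2 0
        simp only [h0] at h4
        exact h3 (by linear_combination h4)
      have h4 : 1 / ((α k : ℂ) ^ 2 * Mt (z n)) = _ := Eq.trans h1 (hfrac (z n) hzn)
      have h5 := (hpoint (z n) hzn h2).2 (mul_eq_of_one_div_eq_div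
        (mul_ne_zero (pow_ne_zero 2 (by exact_mod_cast hαk.ne')) hMt0) h4)
      have h6 : 0 < (x (z n)).im := (hg (z n) hzn).2.1.im_pos _
      exact exists_isStripping_of_fixed (by omega) hcper hzn h6
        (unstrip_eq_self_of_wedge hzn h6 hcne h5)
    choose y hy0 hy using hrev
    intro j hj
    obtain ⟨i, rfl⟩ : ∃ i, j = i + 1 := ⟨j - 1, by omega⟩
    exact coeff_eq_of_isStripping (A := fun j => a (l + 1 + j)) (B := fun j => b (l + 1 + j))
      (fun j hj => hapos _ (by omega)) hcpos (fun n => (hz n).2) hzlim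
      (fun n => (hm (z n) (hz n).2).shift (l + 1)) hy (fun n => (hy0 n).symm) i
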